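/- Let \(C=\left\{\sum_{j=1}^\infty \frac{d_j}{3^j} : d_j\in\{0,2\}\text{ for all } j\ge 1\right\}\) be the middle-third Cantor set, and for integers \(n\ge 1\) let \(a_n=\prod_{k=1}^n k!\). Then \[ \left\{\frac{1}{a_n} : n\ge 1\right\}\cap C=\left\{1,\frac{1}{12}\right\}; \] equivalently, for every integer \(n\ge 1\), \(\frac{1}{a_n}\in C\) if and only if \(n\in\{1,3\}\). -/

import Mathlib

open scoped Nat

/-- The missing-digit set `K_{m,D}`: the real numbers `∑_{j ≥ 1} a_j / m ^ j` with every digit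
`a_j` in `D`. The digit `a_{j+1}` is called `a j` here. -/
def missingDigitSet (m : ℕ) (D : Set ℕ) : Set ℝ :=
  {x | ∃ a : ℕ → ℕ, (∀ j, a j ∈ D) ∧ HasSum (fun j => (a j : ℝ) / (m : ℝ) ^ (j + 1)) x}

/-- For base `3` and digits `0, 2` this is the set obtained by removing open middle thirds. -/
theorem missingDigitSet_three_eq_cantorSet : missingDigitSet 3 {0, 2} = cantorSet := by
  rw [cantorSet_eq_zero_two_ofDigits]
  ext x
  constructor
  · rintro ⟨a, ha, hx⟩
    have hlt : ∀ j, a j < 3 := fun j => by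
      rcases ha j with h | h <;> simp_all
    refine ⟨fun j => ⟨a j, hlt j⟩, fun j h => ?_, ?_⟩
    · have h' : a j = 1 := congrArg Fin.val h
      rcases ha j with h0 | h0 <;> simp_all
    · rw [← hx.tsum_eq, Real.ofDigits]
      refine tsum_congr fun j => ?_
      simp [Real.ofDigitsTerm, div_eq_mul_inv]
  · rintro ⟨a, ha, rfl⟩
    refine ⟨fun j => (a j : ℕ), fun j => ?_, ?_⟩
    · have h : ∀ e : Fin 3, e ≠ 1 → (e : ℕ) = 0 ∨ (e : ℕ) = 2 := by decide
      exact h (a j) (ha j)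
    · have hs : HasSum (Real.ofDigitsTerm a) (Real.ofDigits a) :=
        Real.summable_ofDigitsTerm.hasSum
      convert hs using 2 with j
      simp [Real.ofDigitsTerm, div_eq_mul_inv]

/-! Write `a_n = 3^e * B` with `B = 2^s * c` and `c` prime to 6. If `3^M ≡ 1 + B/2` mod `B`, then
`3^(e+M) / a_n` has fractional part `1/2 + 1/B`, in the open middle third once `B > 6`; so `1/a_n`
is not in `C`. Such an `M` exists when `s ≥ 4 + v₂(φ(c))` (`exists_three_pow_eq_one_add_half`), and
this holds for `n ≥ 4`: `v₂(φ(c)) ≤ v₂((n-1)!)`, and `a_n / (n-1)!` is still divisible by 16. Only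
`n ≤ 3` remains. -/

/-- The Cantor set is invariant under `x ↦ 3 ^ k * x` modulo the integers. -/
theorem exists_int_three_pow_mul_sub_mem_cantorSet {x : ℝ} (hx : x ∈ cantorSet) (k : ℕ) :
    ∃ m : ℤ, 3 ^ k * x - m ∈ cantorSet := by
  induction k with
  | zero => exact ⟨0, by simpa using hx⟩
  | succ k ih =>
    obtain ⟨m, hm⟩ := ih
    rw [cantorSet_eq_union_halves] at hm
    rcases hm with ⟨z, hz, h⟩ | ⟨z, hz, h⟩
    · refine ⟨3 * m, ?_⟩
      have : (3 : ℝ) ^ (k + 1) * x - ((3 * m : ℤ) : ℝ) = z := by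
        push_cast
        rw [pow_succ]
        simp only at h
        linarith
      rwa [this]
    · refine ⟨3 * m + 2, ?_⟩
      have : (3 : ℝ) ^ (k + 1) * x - ((3 * m + 2 : ℤ) : ℝ) = z := by
        push_cast
        rw [pow_succ]
        simp only at h
        linarith
      rwa [this]

theorem le_third_or_two_thirds_le_of_mem_cantorSet {x : ℝ} (hx : x ∈ cantorSet) :
    x ≤ 1 / 3 ∨ 2 / 3 ≤ x := by
  rw [cantorSet_eq_union_halves] at hx
  rcases hx with ⟨z, hz, rfl⟩ | ⟨z, hz, rfl⟩ <;>
    have := cantorSet_subset_unitInterval hz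
  · left
    linarith [this.2]
  · right
    linarith [this.1]

/-- If some `3 ^ k * x` has its fractional part in the open middle third, then `x` is not in the
Cantor set. -/
theorem notMem_cantorSet_of_three_pow_mul_eq {x t : ℝ} {k : ℕ} {N : ℤ} (h : 3 ^ k * x = N + t)
    (ht : 1 / 3 < t) (ht' : t < 2 / 3) : x ∉ cantorSet := by
  intro hx
  obtain ⟨m, hm⟩ := exists_int_three_pow_mul_sub_mem_cantorSet hx k
  have h01 := cantorSet_subset_unitInterval hm
  have hN : N - m = 0 := by
    have h1 : ((N - m : ℤ) : ℝ) < 1 := by push_cast; linarith [h01.2]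
    have h2 : (-1 : ℝ) < ((N - m : ℤ) : ℝ) := by push_cast; linarith [h01.1]
    have h1' : N - m < 1 := by exact_mod_cast h1
    have h2' : -1 < N - m := by exact_mod_cast h2
    omega
  have hN' : (N : ℝ) - m = 0 := by exact_mod_cast hN
  rcases le_third_or_two_thirds_le_of_mem_cantorSet hm with h' | h' <;> linarith

/-- If the power of `2` in `2 ^ s * c` is large enough, some power of `3` is congruent to
`1 + 2 ^ s * c / 2` modulo `2 ^ s * c`. -/
theorem exists_three_pow_eq_one_add_half {s c : ℕ} (hc : Odd c) (hc3 : Nat.Coprime 3 c)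
    (hs : 4 + padicValNat 2 (Nat.totient c) ≤ s) :
    ∃ M K : ℕ, 2 * 3 ^ M = 2 + 2 ^ s * c * (2 * K + 1) := by
  have hc0 : 0 < c := hc.pos
  have hφ : c.totient ≠ 0 := (Nat.totient_pos.2 hc0).ne'
  obtain ⟨j, rfl⟩ := Nat.exists_eq_add_of_le hs
  set v := padicValNat 2 c.totient with hv
  -- The factor `φ(c)` gives `3^M ≡ 1` mod `c`; by lifting the exponent, `v₂(3^M - 1) = v₂(M) + 2`,
  -- and the power of 2 makes this exactly `s - 1`.
  set M := c.totient * 2 ^ (j + 1) with hM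
  have hM0 : M ≠ 0 := by positivity
  have hMval : padicValNat 2 M = v + (j + 1) := by
    rw [hM, padicValNat.mul hφ (by positivity), padicValNat.prime_pow]
  have hMe : Even M := by
    rw [hM, pow_succ]
    exact ⟨c.totient * 2 ^ j, by ring⟩
  have hval : padicValNat 2 (3 ^ M - 1) = v + j + 3 := by
    have h := padicValNat.pow_two_sub_one (x := 3) (n := M) (by norm_num) (by norm_num) hM0 hMe
    have h4 : padicValNat 2 (3 + 1) = 2 := padicValNat.prime_pow (p := 2) 2
    have h2 : padicValNat 2 (3 - 1) = 1 := padicValNat.prime_pow (p := 2) 1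
    rw [h4, h2, hMval] at h
    omega
  have hpos : 1 < 3 ^ M := Nat.one_lt_pow hM0 (by norm_num)
  have hcd : c ∣ 3 ^ M - 1 := by
    rw [← Nat.modEq_iff_dvd' hpos.le, hM, pow_mul]
    simpa using ((Nat.ModEq.pow_totient hc3).pow (2 ^ (j + 1))).symm
  have h2d : 2 ^ (v + j + 3) ∣ 3 ^ M - 1 := hval ▸ pow_padicValNat_dvd
  have hcop : Nat.Coprime (2 ^ (v + j + 3)) c := (Nat.coprime_two_left.2 hc).pow_left _
  obtain ⟨q, hq⟩ := hcop.mul_dvd_of_dvd_of_dvd h2d hcd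
  have hqo : Odd q := by
    rw [← Nat.not_even_iff_odd]
    rintro ⟨r, rfl⟩
    have hd : 2 ^ (v + j + 3 + 1) ∣ 3 ^ M - 1 := ⟨c * r, by rw [hq]; ring⟩
    rw [padicValNat_dvd_iff_le (by omega), hval] at hd
    omega
  obtain ⟨K, rfl⟩ := hqo
  refine ⟨M, K, ?_⟩
  have h3 : 3 ^ M = 1 + 2 ^ (v + j + 3) * c * (2 * K + 1) := by omega
  rw [h3]
  ring

/-- For odd `c` the power of `2` in `φ c` comes from the factors `p - 1`, `p` prime. -/
theorem padicValNat_two_totient_le {c n : ℕ} (hc : Odd c) (hn : ∀ p ∈ c.primeFactors, p ≤ n + 1) :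
    padicValNat 2 c.totient ≤ padicValNat 2 n ! := by
  have hdvd : ∏ p ∈ c.primeFactors, (p - 1) ∣ n ! := by
    have h2 : ∀ p ∈ c.primeFactors, 2 ≤ p := fun p hp =>
      (Nat.prime_of_mem_primeFactors hp).two_le
    -- Distinct primes give distinct factors `p - 1 ≤ n`, so their product is a subproduct of `n !`.
    have hinj : Set.InjOn (fun p => p - 2) (c.primeFactors : Set ℕ) := by
      intro p hp q hq h
      have := h2 p hp
      have := h2 q hq
      simp only at h
      omega
    have himage : ∏ p ∈ c.primeFactors, (p - 1) =
        ∏ k ∈ c.primeFactors.image (fun p => p - 2), (k + 1) := by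
      rw [Finset.prod_image hinj]
      refine Finset.prod_congr rfl fun p hp => ?_
      have := h2 p hp
      omega
    rw [himage, ← Finset.prod_range_add_one_eq_factorial]
    refine Finset.prod_dvd_prod_of_subset _ _ _ fun x hx => ?_
    obtain ⟨p, hp, rfl⟩ := Finset.mem_image.1 hx
    have := h2 p hp
    have := hn p hp
    rw [Finset.mem_range]
    omega
  have hdvd' : c.totient ∣ c * ∏ p ∈ c.primeFactors, (p - 1) :=
    ⟨_, (Nat.totient_mul_prod_primeFactors c).symm⟩
  have h2 : 2 ^ padicValNat 2 c.totient ∣ c * ∏ p ∈ c.primeFactors, (p - 1) :=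
    pow_padicValNat_dvd.trans hdvd'
  have h3 := (((Nat.coprime_two_left.2 hc).pow_left _).dvd_of_dvd_mul_left h2).trans hdvd
  exact (padicValNat_dvd_iff_le n.factorial_ne_zero).1 h3

theorem superFactorial_ne_zero (n : ℕ) : Nat.superFactorial n ≠ 0 := by
  rw [← Nat.prod_Icc_factorial]
  exact Finset.prod_ne_zero_iff.2 fun k _ => k.factorial_ne_zero

theorem le_of_prime_dvd_superFactorial {n p : ℕ} (hp : p.Prime)
    (h : p ∣ Nat.superFactorial n) : p ≤ n := by
  rw [← Nat.prod_Icc_factorial] at h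
  obtain ⟨k, hk, hpk⟩ := (hp.prime.dvd_finsetProd_iff _).1 h
  exact (hp.dvd_factorial.1 hpk).trans (Finset.mem_Icc.1 hk).2

/-- Split off the last two factorials: `(n+3)!` is kept, while `(n+4)!` supplies 24 and the
remaining product supplies 2, hence `2^4`. -/
theorem padicValNat_two_superFactorial_ge (n : ℕ) :
    4 + padicValNat 2 (n + 3)! ≤ padicValNat 2 (Nat.superFactorial (n + 4)) := by
  have h16 : 2 ^ 4 ∣ Nat.superFactorial (n + 2) * (n + 4)! := by
    have h1 : 2 ∣ Nat.superFactorial (n + 2) := by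
      rw [← Nat.prod_Icc_factorial]
      exact Finset.dvd_prod_of_mem (fun k => k !) (a := 2) (Finset.mem_Icc.2 ⟨by norm_num, by omega⟩)
    have h2 : 24 ∣ (n + 4)! := Nat.factorial_dvd_factorial (m := 4) (by omega)
    exact (by norm_num : 2 ^ 4 ∣ 2 * 24).trans (mul_dvd_mul h1 h2)
  rw [padicValNat_dvd_iff_le
    (mul_ne_zero (superFactorial_ne_zero _) (Nat.factorial_ne_zero _))] at h16
  have h : Nat.superFactorial (n + 4) = Nat.superFactorial (n + 2) * (n + 4)! * (n + 3)! := by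
    rw [Nat.superFactorial_succ, Nat.superFactorial_succ]
    ring
  rw [h, padicValNat.mul
    (mul_ne_zero (superFactorial_ne_zero _) (Nat.factorial_ne_zero _))
    (Nat.factorial_ne_zero _)]
  omega

theorem one_div_superFactorial_notMem_cantorSet (n : ℕ) :
    1 / (Nat.superFactorial (n + 4) : ℝ) ∉ cantorSet := by
  set A := Nat.superFactorial (n + 4) with hA
  have hA0 : A ≠ 0 := superFactorial_ne_zero _
  obtain ⟨e, B, hB3, hB⟩ := Nat.exists_eq_pow_mul_and_not_dvd hA0 3 (by norm_num)
  have hB0 : B ≠ 0 := by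
    rintro rfl
    simp at hB3
  obtain ⟨s, c, hc2, hc⟩ := Nat.exists_eq_pow_mul_and_not_dvd hB0 2 (by norm_num)
  have hcodd : Odd c := by
    rw [← Nat.not_even_iff_odd, even_iff_two_dvd]
    exact hc2
  have hcB : c ∣ B := ⟨2 ^ s, by rw [hc]; ring⟩
  have hBA : B ∣ A := ⟨3 ^ e, by rw [hB]; ring⟩
  have hc3 : Nat.Coprime 3 c :=
    (Nat.Prime.coprime_iff_not_dvd Nat.prime_three).2 fun h => hB3 (h.trans hcB)
  have hsA : padicValNat 2 A = s := by
    rw [hB, hc, padicValNat.mul (by positivity) (hc ▸ hB0),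
      padicValNat.mul (by positivity) hcodd.pos.ne', padicValNat.prime_pow,
      padicValNat.eq_zero_of_not_dvd hc2,
      padicValNat.eq_zero_of_not_dvd
        (fun h => by simpa using Nat.Prime.dvd_of_dvd_pow Nat.prime_two h)]
    simp
  have hs : 4 + padicValNat 2 c.totient ≤ s := by
    have h1 := padicValNat_two_superFactorial_ge n
    rw [← hA, hsA] at h1
    refine le_trans ?_ h1
    gcongr
    exact padicValNat_two_totient_le hcodd fun p hp =>
      le_of_prime_dvd_superFactorial (Nat.prime_of_mem_primeFactors hp)
        (((Nat.dvd_of_mem_primeFactors hp).trans hcB).trans hBA)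
  obtain ⟨M, K, hMK⟩ := exists_three_pow_eq_one_add_half hcodd hc3 hs
  rw [← hc] at hMK
  -- This is what puts `1/2 + 1/B` below `2/3`.
  have hB6 : 6 < B := by
    have h1 : 2 ^ 4 ≤ 2 ^ s := Nat.pow_le_pow_right (by norm_num) (by omega)
    have h2 : 2 ^ s ≤ B := Nat.le_of_dvd (Nat.pos_of_ne_zero hB0) ⟨c, hc⟩
    omega
  have hB6' : (6 : ℝ) < B := by exact_mod_cast hB6
  have hMK' : (2 : ℝ) * 3 ^ M = 2 + B * (2 * K + 1) := by exact_mod_cast hMK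
  have hlt : 1 / (B : ℝ) < 1 / 6 := one_div_lt_one_div_of_lt (by norm_num) hB6'
  have hgt : 0 < 1 / (B : ℝ) := by positivity
  refine notMem_cantorSet_of_three_pow_mul_eq (k := e + M) (N := (K : ℤ)) (t := 1 / 2 + 1 / B)
    ?_ (by linarith) (by linarith)
  rw [hB]
  push_cast
  rw [pow_add]
  field_simp
  linarith

theorem one_mem_cantorSet : (1 : ℝ) ∈ cantorSet := by
  refine Set.mem_iInter.2 fun n => ?_
  induction n with
  | zero => simp
  | succ n ih => exact Or.inr ⟨1, ih, by norm_num⟩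

theorem one_div_twelve_mem_cantorSet : (1 / 12 : ℝ) ∈ cantorSet := by
  rw [cantorSet_eq_union_halves]
  exact Or.inl ⟨1 / 4, quarter_mem_cantorSet, by norm_num⟩

theorem one_div_superFactorial_mem_cantorSet_iff {n : ℕ} (hn : 1 ≤ n) :
    1 / (Nat.superFactorial n : ℝ) ∈ cantorSet ↔ n = 1 ∨ n = 3 := by
  have h1 : Nat.superFactorial 1 = 1 := by decide
  have h2 : Nat.superFactorial 2 = 2 := by decide
  have h3 : Nat.superFactorial 3 = 12 := by decide
  obtain rfl | rfl | rfl | ⟨m, rfl⟩ : n = 1 ∨ n = 2 ∨ n = 3 ∨ ∃ m, n = m + 4 := by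
    by_cases h : n < 4
    · omega
    · exact Or.inr (Or.inr (Or.inr ⟨n - 4, by omega⟩))
  · simpa [h1] using one_mem_cantorSet
  · have : (1 / 2 : ℝ) ∉ cantorSet := fun h => by
      rcases le_third_or_two_thirds_le_of_mem_cantorSet h with h | h <;> norm_num at h
    simpa [h2] using this
  · simpa [h3] using one_div_twelve_mem_cantorSet
  · exact iff_of_false (one_div_superFactorial_notMem_cantorSet m) (by omega)

theorem mainTheorem11 (C : Set ℝ) (hC : C = missingDigitSet 3 {0, 2})
    (a : ℕ → ℕ) (ha : ∀ n, a n = ∏ k ∈ Finset.Icc 1 n, k !) :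
    {x : ℝ | ∃ n : ℕ, 1 ≤ n ∧ x = 1 / (a n : ℝ)} ∩ C = {1, 1 / 12} ∧
      ∀ n : ℕ, 1 ≤ n → (1 / (a n : ℝ) ∈ C ↔ n = 1 ∨ n = 3) := by
  have hiff : ∀ n : ℕ, 1 ≤ n → (1 / (a n : ℝ) ∈ C ↔ n = 1 ∨ n = 3) := by
    intro n hn
    rw [hC, missingDigitSet_three_eq_cantorSet, ha, Nat.prod_Icc_factorial]
    exact one_div_superFactorial_mem_cantorSet_iff hn
  have h1 : a 1 = 1 := by rw [ha]; decide
  have h3 : a 3 = 12 := by rw [ha]; decide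
  refine ⟨?_, hiff⟩
  ext x
  constructor
  · rintro ⟨⟨n, hn, rfl⟩, hx⟩
    rcases (hiff n hn).1 hx with rfl | rfl
    · left
      simp [h1]
    · right
      simp [h3]
  · rintro (rfl | rfl)
    · exact ⟨⟨1, le_rfl, by simp [h1]⟩, by simpa [h1] using (hiff 1 le_rfl).2 (Or.inl rfl)⟩
    · exact ⟨⟨3, by norm_num, by simp [h3]⟩,
        by simpa [h3] using (hiff 3 (by norm_num)).2 (Or.inr rfl)⟩
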